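/- Let $X$ be a connected, non-compact metric space in which all closed balls are compact, equipped with a Borel measure $m$ such that no non-zero operator of multiplication by a function $f\in C_0(X)$ on $L^2(X)=L^2(X,m)$ is compact (for example, such that $m$ has no atoms). Suppose that $X$ has bounded geometry: there is $r>0$ such that for every $R>0$ there is $N\in\mathbb N$ such that every ball of radius $R$ is covered by at most $N$ balls of radius $r$. Let $D\subset X$ be uniformly discrete (there is $\varepsilon>0$ with $d(x,y)\ge\varepsilon$ for all distinct $x,y\in D$) and coarsely equivalent to $X$ (there is $C>0$ such that every $x\in X$ satisfies $d(x,y)<C$ for some $y\in D$). Let $\{\phi_x\}_{x\in D}\subset L^2(X)$ be a Wannier basis with localization centers $D$, that is: $\|\phi_x\|_2=1$ and $x\in\operatorname{supp}\phi_x$ for all $x\in D$; $\operatorname{supp}\phi_x\cap\operatorname{supp}\phi_y=\emptyset$ for $x\ne y$; and the diameters of the sets $\operatorname{supp}\phi_x$, $x\in D$, are uniformly bounded. Here $\operatorname{supp}$ is the essential support, i.e. the complement of the largest open set on which the function vanishes almost everywhere. Let $p_\phi$ be the orthogonal projection of $L^2(X)$ onto the closed linear span of $\{\phi_x:x\in D\}$.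 Let $C^*(X)\subset\mathbb B(L^2(X))$ be the Roe algebra, i.e. the norm closure of the $*$-algebra of the bounded operators $T$ that are locally compact ($Tf$ and $fT$ are compact for all $f\in C_0(X)$, acting by multiplication) and have finite propagation (there is $R>0$ such that $fTg=0$ for all $f,g\in C_0(X)$ whose supports are at distance greater than $R$). Then $p_\phi\in C^*(X)$ and $[p_\phi]=0$ in $K_0(C^*(X))$. -/

import Mathlib

open MeasureTheory Topology
open scoped ENNReal ZeroAtInfty Matrix

noncomputable section

/-! ## The group `K₀` of a `C*`-algebra

For a unital algebra `R`, `K₀(R)` is the Grothendieck group of the monoid of Murray-von Neumann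
classes of projections in matrices of all sizes over `R`. For an algebra `A` not assumed unital,
`K₀(A)` is the kernel of the map `K₀(A⁺) → K₀(ℂ)` induced by the augmentation `A⁺ → ℂ`, where
`A⁺` is the unitization of `A`. -/

namespace KTheory

section Unital

variable {R : Type*} [Ring R] [StarRing R]

/-- Murray-von Neumann equivalence of square matrices `p`, `q`, possibly of different sizes:
`p = v* v` and `q = v v*` for some rectangular matrix `v`. -/
def MvN {m n : Type*} [Fintype m] [Fintype n] (p : Matrix m m R) (q : Matrix n n R) : Prop :=
  ∃ v : Matrix n m R, vᴴ * v = p ∧ v * vᴴ = q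

theorem MvN.refl {m : Type*} [Fintype m] {p : Matrix m m R} (hp : IsStarProjection p) :
    MvN p p := by
  have h1 : pᴴ = p := hp.isSelfAdjoint
  have h2 : p * p = p := hp.isIdempotentElem
  exact ⟨p, by rw [h1, h2], by rw [h1, h2]⟩

theorem MvN.symm {m n : Type*} [Fintype m] [Fintype n] {p : Matrix m m R} {q : Matrix n n R}
    (h : MvN p q) : MvN q p := by
  obtain ⟨v, h1, h2⟩ := h
  exact ⟨vᴴ, by rw [Matrix.conjTranspose_conjTranspose, h2],
    by rw [Matrix.conjTranspose_conjTranspose, h1]⟩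

theorem MvN.trans {l m n : Type*} [Fintype l] [Fintype m] [Fintype n]
    {p : Matrix l l R} {q : Matrix m m R} {r : Matrix n n R}
    (hp : IsStarProjection p) (hr : IsStarProjection r)
    (h : MvN p q) (h' : MvN q r) : MvN p r := by
  obtain ⟨v, h1, h2⟩ := h
  obtain ⟨w, h3, h4⟩ := h'
  have hp2 : p * p = p := hp.isIdempotentElem
  have hr2 : r * r = r := hr.isIdempotentElem
  refine ⟨w * v, ?_, ?_⟩
  · calc (w * v)ᴴ * (w * v) = vᴴ * (wᴴ * w) * v := by
          simp only [Matrix.conjTranspose_mul, Matrix.mul_assoc]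
      _ = (vᴴ * v) * (vᴴ * v) := by rw [h3, ← h2]; simp only [Matrix.mul_assoc]
      _ = p := by rw [h1, hp2]
  · calc (w * v) * (w * v)ᴴ = w * (v * vᴴ) * wᴴ := by
          simp only [Matrix.conjTranspose_mul, Matrix.mul_assoc]
      _ = (w * wᴴ) * (w * wᴴ) := by rw [h2, ← h3]; simp only [Matrix.mul_assoc]
      _ = r := by rw [h4, hr2]

/-- Relabelling the rows and columns of a projection gives an equivalent projection. -/
theorem MvN.submatrix {m n : Type*} [Fintype m] [Fintype n]
    {p : Matrix m m R} (hp : IsStarProjection p) (e : n ≃ m) : MvN p (p.submatrix e e) := by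
  have h1 : pᴴ = p := hp.isSelfAdjoint
  have h2 : p * p = p := hp.isIdempotentElem
  refine ⟨p.submatrix e id, ?_, ?_⟩
  · rw [Matrix.conjTranspose_submatrix, h1, Matrix.submatrix_mul_equiv, h2, Matrix.submatrix_id_id]
  · rw [Matrix.conjTranspose_submatrix, h1,
      ← Matrix.submatrix_mul p p e id e Function.bijective_id, h2]

theorem isStarProjection_submatrix {m n : Type*} [Fintype m] [Fintype n]
    {p : Matrix m m R} (hp : IsStarProjection p) (e : n ≃ m) :
    IsStarProjection (p.submatrix e e) := by
  have h1 : pᴴ = p := hp.isSelfAdjoint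
  have h2 : p * p = p := hp.isIdempotentElem
  constructor
  · change _ * _ = _
    rw [Matrix.submatrix_mul_equiv, h2]
  · change (p.submatrix e e)ᴴ = _
    rw [Matrix.conjTranspose_submatrix, h1]

/-- The block sum `p ⊕ q = diag(p, q)`. -/
def blockSum {m n : Type*} (p : Matrix m m R) (q : Matrix n n R) : Matrix (m ⊕ n) (m ⊕ n) R :=
  Matrix.fromBlocks p 0 0 q

theorem isStarProjection_blockSum {m n : Type*} [Fintype m] [Fintype n]
    {p : Matrix m m R} {q : Matrix n n R} (hp : IsStarProjection p) (hq : IsStarProjection q) :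
    IsStarProjection (blockSum p q) := by
  have h1 : pᴴ = p := hp.isSelfAdjoint
  have h2 : p * p = p := hp.isIdempotentElem
  have h3 : qᴴ = q := hq.isSelfAdjoint
  have h4 : q * q = q := hq.isIdempotentElem
  constructor
  · change _ * _ = _
    simp [blockSum, Matrix.fromBlocks_multiply, h2, h4]
  · change (blockSum p q)ᴴ = _
    simp [blockSum, Matrix.fromBlocks_conjTranspose, h1, h3]

theorem MvN.blockSum {m n m' n' : Type*} [Fintype m] [Fintype n] [Fintype m'] [Fintype n']
    {p : Matrix m m R} {q : Matrix n n R} {p' : Matrix m' m' R} {q' : Matrix n' n' R}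
    (h : MvN p p') (h' : MvN q q') : MvN (blockSum p q) (blockSum p' q') := by
  obtain ⟨v, h1, h2⟩ := h
  obtain ⟨w, h3, h4⟩ := h'
  refine ⟨Matrix.fromBlocks v 0 0 w, ?_, ?_⟩
  · simp [KTheory.blockSum, Matrix.fromBlocks_multiply, Matrix.fromBlocks_conjTranspose, h1, h3]
  · simp [KTheory.blockSum, Matrix.fromBlocks_multiply, Matrix.fromBlocks_conjTranspose, h2, h4]

variable (R) in
/-- Projections in the matrix algebras `Mₙ(R)`, `n = 0, 1, 2, …`. -/
abbrev MatProj : Type _ := Σ n : ℕ, {p : Matrix (Fin n) (Fin n) R // IsStarProjection p}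

variable (R) in
/-- Murray-von Neumann equivalence of projections in the matrix algebras over `R`. -/
instance matProjSetoid : Setoid (MatProj R) where
  r p q := MvN p.2.1 q.2.1
  iseqv := ⟨fun p => MvN.refl p.2.2, fun h => h.symm, fun {p _ r} h h' => h.trans p.2.2 r.2.2 h'⟩

/-- The sum `p ⊕ q ∈ M_{m+n}(R)` of projections `p ∈ Mₘ(R)`, `q ∈ Mₙ(R)`. -/
def MatProj.add (p q : MatProj R) : MatProj R :=
  ⟨p.1 + q.1, (blockSum p.2.1 q.2.1).submatrix finSumFinEquiv.symm finSumFinEquiv.symm,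
    isStarProjection_submatrix (isStarProjection_blockSum p.2.2 q.2.2) _⟩

theorem MatProj.mvn_add (p q : MatProj R) : MvN (blockSum p.2.1 q.2.1) (p.add q).2.1 :=
  MvN.submatrix (isStarProjection_blockSum p.2.2 q.2.2) _

variable (R) in
/-- The monoid of Murray-von Neumann classes of projections in matrices over `R`. -/
def ProjMonoid : Type _ := Quotient (matProjSetoid R)

/-- The Murray-von Neumann class of a projection. -/
def ProjMonoid.mk (p : MatProj R) : ProjMonoid R := Quotient.mk _ p

theorem MatProj.add_congr {p p' q q' : MatProj R} (h : MvN p.2.1 p'.2.1) (h' : MvN q.2.1 q'.2.1) :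
    MvN (p.add q).2.1 (p'.add q').2.1 :=
  MvN.trans (p.add q).2.2 (p'.add q').2.2
    (MvN.trans (p.add q).2.2 (isStarProjection_blockSum p'.2.2 q'.2.2)
      (p.mvn_add q).symm (h.blockSum h')) (p'.mvn_add q')

theorem MvN.blockSum_comm {m n : Type*} [Fintype m] [Fintype n]
    {p : Matrix m m R} {q : Matrix n n R} (hp : IsStarProjection p) (hq : IsStarProjection q) :
    MvN (KTheory.blockSum p q) (KTheory.blockSum q p) := by
  have h := MvN.submatrix (isStarProjection_blockSum hp hq) (Equiv.sumComm n m)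
  have e : (KTheory.blockSum p q).submatrix (Equiv.sumComm n m) (Equiv.sumComm n m)
      = KTheory.blockSum q p := by
    ext i j
    rcases i with i | i <;> rcases j with j | j <;> rfl
  rwa [e] at h

theorem MvN.blockSum_assoc {l m n : Type*} [Fintype l] [Fintype m] [Fintype n]
    {p : Matrix l l R} {q : Matrix m m R} {r : Matrix n n R} (hp : IsStarProjection p)
    (hq : IsStarProjection q) (hr : IsStarProjection r) :
    MvN (KTheory.blockSum (KTheory.blockSum p q) r)
      (KTheory.blockSum p (KTheory.blockSum q r)) := by
  have h := MvN.submatrix (isStarProjection_blockSum (isStarProjection_blockSum hp hq) hr)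
    (Equiv.sumAssoc l m n).symm
  have e : (KTheory.blockSum (KTheory.blockSum p q) r).submatrix (Equiv.sumAssoc l m n).symm
      (Equiv.sumAssoc l m n).symm = KTheory.blockSum p (KTheory.blockSum q r) := by
    ext i j
    rcases i with i | i | i <;> rcases j with j | j | j <;> rfl
  rwa [e] at h

theorem MvN.blockSum_empty {l m : Type*} [Fintype l] [Fintype m] [IsEmpty l]
    {p : Matrix l l R} {q : Matrix m m R} (hp : IsStarProjection p) (hq : IsStarProjection q) :
    MvN (KTheory.blockSum p q) q := by
  have h := MvN.submatrix (isStarProjection_blockSum hp hq) (Equiv.emptySum l m).symm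
  have e : (KTheory.blockSum p q).submatrix (Equiv.emptySum l m).symm (Equiv.emptySum l m).symm
      = q := by
    ext i j
    rfl
  rwa [e] at h

instance : Zero (ProjMonoid R) := ⟨ProjMonoid.mk ⟨0, 0, IsStarProjection.zero _⟩⟩

instance : Add (ProjMonoid R) :=
  ⟨Quotient.map₂ MatProj.add fun _ _ h _ _ h' => MatProj.add_congr h h'⟩

instance : AddCommMonoid (ProjMonoid R) where
  nsmul := nsmulRec
  add_assoc := by
    rintro ⟨p⟩ ⟨q⟩ ⟨r⟩
    refine Quotient.sound ?_
    change MvN ((p.add q).add r).2.1 (p.add (q.add r)).2.1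
    have h1 : MvN ((p.add q).add r).2.1 (blockSum (blockSum p.2.1 q.2.1) r.2.1) :=
      MvN.trans (MatProj.add _ _).2.2
        (isStarProjection_blockSum (isStarProjection_blockSum p.2.2 q.2.2) r.2.2)
        (MatProj.mvn_add _ _).symm ((MatProj.mvn_add _ _).symm.blockSum (MvN.refl r.2.2))
    have h2 : MvN (p.add (q.add r)).2.1 (blockSum p.2.1 (blockSum q.2.1 r.2.1)) :=
      MvN.trans (MatProj.add _ _).2.2
        (isStarProjection_blockSum p.2.2 (isStarProjection_blockSum q.2.2 r.2.2))
        (MatProj.mvn_add _ _).symm ((MvN.refl p.2.2).blockSum (MatProj.mvn_add _ _).symm)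
    exact MvN.trans (MatProj.add _ _).2.2 (MatProj.add _ _).2.2
      (MvN.trans (MatProj.add _ _).2.2
        (isStarProjection_blockSum p.2.2 (isStarProjection_blockSum q.2.2 r.2.2)) h1
        (MvN.blockSum_assoc p.2.2 q.2.2 r.2.2)) h2.symm
  add_comm := by
    rintro ⟨p⟩ ⟨q⟩
    refine Quotient.sound ?_
    change MvN (p.add q).2.1 (q.add p).2.1
    exact MvN.trans (MatProj.add _ _).2.2 (MatProj.add _ _).2.2
      (MvN.trans (MatProj.add _ _).2.2 (isStarProjection_blockSum q.2.2 p.2.2)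
        (p.mvn_add q).symm (MvN.blockSum_comm p.2.2 q.2.2)) (q.mvn_add p)
  zero_add := by
    rintro ⟨p⟩
    refine Quotient.sound ?_
    change MvN (MatProj.add _ p).2.1 p.2.1
    exact MvN.trans (MatProj.add _ _).2.2 p.2.2 (MatProj.mvn_add _ p).symm
      (MvN.blockSum_empty (IsStarProjection.zero _) p.2.2)
  add_zero := by
    rintro ⟨p⟩
    refine Quotient.sound ?_
    change MvN (MatProj.add p _).2.1 p.2.1
    exact MvN.trans (MatProj.add _ _).2.2 p.2.2
      (MvN.trans (MatProj.add _ _).2.2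
        (isStarProjection_blockSum (IsStarProjection.zero _) p.2.2) (MatProj.mvn_add p _).symm
        (MvN.blockSum_comm p.2.2 (IsStarProjection.zero _)))
      (MvN.blockSum_empty (IsStarProjection.zero _) p.2.2)

variable (R) in
/-- `K₀` of a unital algebra. -/
abbrev UnitalK0 : Type _ := Algebra.GrothendieckAddGroup (ProjMonoid R)

end Unital

section Functoriality

variable {R S : Type*} [Ring R] [StarRing R] [Algebra ℂ R] [Ring S] [StarRing S] [Algebra ℂ S]

theorem MvN.map {m n : Type*} [Fintype m] [Fintype n] (φ : R →⋆ₐ[ℂ] S) {p : Matrix m m R}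
    {q : Matrix n n R} (h : MvN p q) : MvN (p.map φ) (q.map φ) := by
  obtain ⟨v, h1, h2⟩ := h
  refine ⟨v.map φ, ?_, ?_⟩
  · rw [← Matrix.conjTranspose_map φ (fun x => map_star φ x), ← Matrix.map_mul, h1]
  · rw [← Matrix.conjTranspose_map φ (fun x => map_star φ x), ← Matrix.map_mul, h2]

theorem blockSum_map {m n : Type*} (φ : R →⋆ₐ[ℂ] S) (p : Matrix m m R) (q : Matrix n n R) :
    (blockSum p q).map φ = blockSum (p.map φ) (q.map φ) := by
  simp [blockSum, Matrix.fromBlocks_map]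

/-- The image of a projection over `R` under a unital `*`-homomorphism, applied entrywise. -/
def MatProj.map (φ : R →⋆ₐ[ℂ] S) (p : MatProj R) : MatProj S :=
  ⟨p.1, p.2.1.map φ, by
    have h1 : (p.2.1)ᴴ = p.2.1 := p.2.2.isSelfAdjoint
    have h2 : p.2.1 * p.2.1 = p.2.1 := p.2.2.isIdempotentElem
    constructor
    · change _ * _ = _
      rw [← Matrix.map_mul, h2]
    · change (p.2.1.map φ)ᴴ = _
      rw [← Matrix.conjTranspose_map φ (fun x => map_star φ x), h1]⟩

/-- The map of monoids of projections induced by a unital `*`-homomorphism. -/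
def ProjMonoid.map (φ : R →⋆ₐ[ℂ] S) : ProjMonoid R →+ ProjMonoid S where
  toFun := Quotient.map (MatProj.map φ) fun _ _ h => MvN.map φ h
  map_zero' := by
    refine Quotient.sound ?_
    refine ⟨0, ?_, ?_⟩
    · ext i; exact i.elim0
    · ext i; exact i.elim0
  map_add' := by
    rintro ⟨p⟩ ⟨q⟩
    have e : MatProj.map φ (p.add q) = (p.map φ).add (q.map φ) := by
      refine Sigma.ext rfl (heq_of_eq (Subtype.ext ?_))
      change ((blockSum p.2.1 q.2.1).submatrix _ _).map φ
        = (blockSum (p.2.1.map φ) (q.2.1.map φ)).submatrix _ _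
      rw [← blockSum_map]
      rfl
    exact congrArg ProjMonoid.mk e

/-- The homomorphism `K₀(R) → K₀(S)` induced by a unital `*`-homomorphism. -/
def UnitalK0.map (φ : R →⋆ₐ[ℂ] S) : UnitalK0 R →+ UnitalK0 S :=
  Algebra.GrothendieckAddGroup.lift
    ((Algebra.GrothendieckAddGroup.of (M := ProjMonoid S)).comp (ProjMonoid.map φ))

end Functoriality

section NonUnital

variable (A : Type*) [NonUnitalRing A] [StarRing A] [Module ℂ A] [IsScalarTower ℂ A A]
  [SMulCommClass ℂ A A] [StarModule ℂ A]

/-- The augmentation `A⁺ → ℂ`, `(c, a) ↦ c`, with kernel `A`. -/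
def augmentation : Unitization ℂ A →⋆ₐ[ℂ] ℂ where
  __ := Unitization.fstHom ℂ A
  map_star' := fun _ => rfl

/-- `K₀(A) = ker (K₀(A⁺) → K₀(ℂ))`. -/
def K0 : AddSubgroup (UnitalK0 (Unitization ℂ A)) := (UnitalK0.map (augmentation A)).ker

variable {A}

/-- A projection `p ∈ A`, as a `1 × 1` matrix over the unitization of `A`. -/
def projMat (p : A) (hp : IsStarProjection p) : MatProj (Unitization ℂ A) :=
  ⟨1, Matrix.of fun _ _ => (p : Unitization ℂ A), by
    have h1 : star p = p := hp.isSelfAdjoint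
    have h2 : p * p = p := hp.isIdempotentElem
    constructor
    · change _ * _ = _
      refine Matrix.ext fun i j => ?_
      simp [Matrix.mul_apply, ← Unitization.inr_mul, h2]
    · change Matrix.conjTranspose _ = _
      refine Matrix.ext fun i j => ?_
      simp [← Unitization.inr_star, h1]⟩

/-- The class `[p] ∈ K₀(A)` of a projection `p ∈ A`. -/
def K0.mk (p : A) (hp : IsStarProjection p) : K0 A :=
  ⟨Algebra.GrothendieckAddGroup.of (ProjMonoid.mk (projMat p hp)), by
    have e : ProjMonoid.map (augmentation A) (ProjMonoid.mk (projMat p hp)) = 0 := by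
      refine Quotient.sound ?_
      refine ⟨0, ?_, ?_⟩
      · ext i j
        change (∑ k : Fin 0, (0 : Matrix (Fin 1) (Fin 0) ℂ) i k * (0 : Matrix (Fin 0) (Fin 1) ℂ) k j)
          = (p : Unitization ℂ A).fst
        simp
      · ext i; exact i.elim0
    change UnitalK0.map (augmentation A) _ = 0
    have h : UnitalK0.map (augmentation A)
        (Algebra.GrothendieckAddGroup.of (ProjMonoid.mk (projMat p hp)))
        = Algebra.GrothendieckAddGroup.of
          (ProjMonoid.map (augmentation A) (ProjMonoid.mk (projMat p hp))) := by
      have := Algebra.GrothendieckAddGroup.lift.symm_apply_apply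
        ((Algebra.GrothendieckAddGroup.of (M := ProjMonoid ℂ)).comp
          (ProjMonoid.map (augmentation A)))
      exact DFunLike.congr_fun this (ProjMonoid.mk (projMat p hp))
    rw [h, e, map_zero]⟩

end NonUnital

end KTheory

/-! ## The Roe algebra -/

namespace RoeAlgebra

variable {X : Type*} [MetricSpace X] [MeasurableSpace X] [BorelSpace X]

/-- `L²(X, m)`, complex valued. -/
abbrev L2 (m : Measure X) : Type _ := Lp ℂ 2 m

theorem memLp_top (m : Measure X) (f : C₀(X, ℂ)) : MemLp f ∞ m :=
  memLp_top_of_bound f.continuous.aestronglyMeasurable ‖f.toBCF‖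
    (Filter.Eventually.of_forall fun x => f.toBCF.norm_coe_le_norm x)

/-- The action of `C₀(X)` on `L²(X)` by multiplication. -/
def mulOp (m : Measure X) (f : C₀(X, ℂ)) : L2 m →L[ℂ] L2 m :=
  (ContinuousLinearMap.mul ℂ ℂ).holderL m ∞ 2 2 ((memLp_top m f).toLp f)

theorem mulOp_coeFn (m : Measure X) (f : C₀(X, ℂ)) (ξ : L2 m) :
    mulOp m f ξ =ᵐ[m] fun x => f x * ξ x := by
  have h : mulOp m f ξ
      = (ContinuousLinearMap.mul ℂ ℂ).holder 2 ((memLp_top m f).toLp f) ξ := rfl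
  rw [h]
  filter_upwards [(ContinuousLinearMap.mul ℂ ℂ).coeFn_holder (r := 2) ((memLp_top m f).toLp f) ξ,
    (memLp_top m f).coeFn_toLp] with x hx hx'
  rw [hx, hx']
  rfl

/-- `L²(X)` is ample: no non-zero operator of multiplication by a function in `C₀(X)` is compact.
This is implied both by the absence of atoms of `m` and by the condition that `f` acts by a compact
operator only if `f = 0`. -/
def IsAmple (m : Measure X) : Prop :=
  ∀ f : C₀(X, ℂ), IsCompactOperator (mulOp m f) → mulOp m f = 0

/-- Local compactness: `T f` and `f T` are compact for all `f ∈ C₀(X)`. -/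
def IsLocallyCompactOp (m : Measure X) (T : L2 m →L[ℂ] L2 m) : Prop :=
  ∀ f : C₀(X, ℂ), IsCompactOperator (T ∘L mulOp m f) ∧ IsCompactOperator (mulOp m f ∘L T)

/-- Finite propagation: for some `R > 0`, `f T g = 0` whenever `f, g ∈ C₀(X)` have supports at
distance greater than `R`. -/
def HasFinitePropagation (m : Measure X) (T : L2 m →L[ℂ] L2 m) : Prop :=
  ∃ R : ℝ, 0 < R ∧ ∀ f g : C₀(X, ℂ),
    (∀ x ∈ tsupport f, ∀ y ∈ tsupport g, R < dist x y) → mulOp m f ∘L T ∘L mulOp m g = 0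

/-- The Roe algebra of `X` acting on `L²(X)`: the norm closure of the `*`-algebra of locally
compact operators of finite propagation. These operators form a `*`-algebra, so the
`*`-algebra that they generate consists of these operators only. -/
def roeAlgebra (m : Measure X) : NonUnitalStarSubalgebra ℂ (L2 m →L[ℂ] L2 m) :=
  (NonUnitalStarAlgebra.adjoin ℂ
    {T : L2 m →L[ℂ] L2 m |
      IsLocallyCompactOp m T ∧ HasFinitePropagation m T}).topologicalClosure

end RoeAlgebra

/-! ## Wannier projections -/

namespace Wannier

open RoeAlgebra

variable {X : Type*} [MetricSpace X]

/-- Bounded geometry: there is `r > 0` such that for every `R > 0` the balls of radius `R` are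
covered by a uniformly bounded number of balls of radius `r`. -/
def HasBoundedGeometry (X : Type*) [MetricSpace X] : Prop :=
  ∃ r : ℝ, 0 < r ∧ ∀ R : ℝ, 0 < R → ∃ N : ℕ, ∀ x : X, ∃ S : Finset X,
    S.card ≤ N ∧ Metric.closedBall x R ⊆ ⋃ y ∈ S, Metric.closedBall y r

/-- `D` is uniformly discrete: distinct points of `D` are at distance bounded below. -/
def UniformlyDiscrete (D : Set X) : Prop :=
  ∃ ε : ℝ, 0 < ε ∧ ∀ x ∈ D, ∀ y ∈ D, x ≠ y → ε ≤ dist x y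

/-- The inclusion of the subset `D` into `X` is a coarse equivalence. -/
def CoarselyDense (D : Set X) : Prop :=
  ∃ C : ℝ, 0 < C ∧ ∀ x : X, ∃ y ∈ D, dist x y < C

variable [MeasurableSpace X] [BorelSpace X]

/-- The (essential, closed) support of a function in `L²(X)`: the complement of the largest open
set on which the function vanishes almost everywhere. -/
def essSupport {m : Measure X} (ξ : L2 m) : Set X :=
  {x | ∀ U : Set X, IsOpen U → x ∈ U → ¬ ∀ᵐ y ∂m, y ∈ U → ξ y = 0}

/-- A `D`-compactly supported Wannier basis: functions `φ x` in `L²(X)`, `x ∈ D`, of norm one,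
with disjoint supports of uniformly bounded diameters, such that `x ∈ supp (φ x)`. -/
structure IsWannierBasis {m : Measure X} (D : Set X) (φ : D → L2 m) : Prop where
  disjoint : ∀ x y : D, x ≠ y → Disjoint (essSupport (φ x)) (essSupport (φ y))
  mem : ∀ x : D, (x : X) ∈ essSupport (φ x)
  bounded : ∃ C : ℝ, ∀ x : D, ∀ y ∈ essSupport (φ x), ∀ z ∈ essSupport (φ x), dist y z ≤ C
  norm_eq_one : ∀ x : D, ‖φ x‖ = 1

/-- The orthogonal projection onto the closed linear span of the functions `φ x`. -/
def proj {m : Measure X} {D : Set X} (φ : D → L2 m) : L2 m →L[ℂ] L2 m :=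
  (Submodule.span ℂ (Set.range φ)).topologicalClosure.starProjection

end Wannier

end

/-! The proof is an Eilenberg swindle along rays that run off to infinity. Join points of `D` at
distance less than `2C`, where `C` is the coarse density constant. Connectedness of `X` makes this
graph connected, properness makes it locally finite, and non-compactness makes it infinite. A
König-type argument then gives a ray from each `x` in `D` such that all the rays together visit each
vertex finitely often (`exists_locallyFinite_rays`). Ampleness provides orthonormal functions `u (x,
n)`, each concentrated near the `n`-th point of the ray from `x`.

Let `p` and `q` be the projections onto the closed spans of `φ` and `u`. Let `v` send `φ x` to `u
(x, 0)`, and let `w` send `u (x, n)` to `u (x, n + 1)`. The ranges of `v` and `w` are orthogonal and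
together make up the range of `q`, so the row `(v, w)` implements `p ⊕ q ∼ q`. Hence `[p] + [q] =
[q]`, and `[p] = 0`.

All four operators lie in the Roe algebra (`transfer_mem_roeAlgebra`): bounded steps along the rays
give finite propagation, and local finiteness of the centers gives local compactness. -/

/-! ### Cancellation in K-theory -/

namespace KTheory

/-- The swindle: if `p ⊕ q` is equivalent to `q` by a row `(v, w)` over `A`, then `[p] = 0`. -/
theorem K0.mk_eq_zero_of_row {A : Type*} [NonUnitalRing A] [StarRing A] [Module ℂ A]
    [IsScalarTower ℂ A A] [SMulCommClass ℂ A A] [StarModule ℂ A] {p q v w : A}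
    (hp : IsStarProjection p) (hq : IsStarProjection q)
    (hv : star v * v = p) (hw : star w * w = q) (hvw : star v * w = 0)
    (hsum : v * star v + w * star w = q) : K0.mk p hp = 0 := by
  have hwv : star w * v = 0 := by simpa using congrArg star hvw
  have key : MvN (m := Fin 1 ⊕ Fin 1) (n := Fin 1) (R := Unitization ℂ A)
      (blockSum (Matrix.of fun _ _ => (p : Unitization ℂ A)) (Matrix.of fun _ _ => (q : _)))
      (Matrix.of fun _ _ => (q : Unitization ℂ A)) := by
    refine ⟨Matrix.of fun _ => Sum.elim (fun _ => (v : Unitization ℂ A)) (fun _ => w), ?_, ?_⟩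
    · refine Matrix.ext fun i j => ?_
      rcases i with i | i <;> rcases j with j | j <;>
        simp [Matrix.mul_apply, blockSum, ← Unitization.inr_star,
          ← Unitization.inr_mul, hv, hw, hvw, hwv]
    · refine Matrix.ext fun i j => ?_
      simp [Matrix.mul_apply, ← Unitization.inr_star, ← Unitization.inr_mul,
        ← Unitization.inr_add, hsum]
  have hmonoid : ProjMonoid.mk (projMat p hp) + ProjMonoid.mk (projMat q hq)
      = ProjMonoid.mk (projMat q hq) :=
    Quotient.sound (MvN.trans (MatProj.add _ _).2.2 (projMat q hq).2.2
      (MatProj.mvn_add _ _).symm key)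
  have h := congrArg (Algebra.GrothendieckAddGroup.of (M := ProjMonoid (Unitization ℂ A))) hmonoid
  -- Classes cancel in the Grothendieck group, though not in general in the monoid of projections.
  rw [map_add, add_eq_right] at h
  exact Subtype.ext h

end KTheory

/-! ### Locally finite families of rays in graphs -/

namespace SimpleGraph

variable {V : Type*}

/-- In a connected infinite locally finite graph every vertex is the origin of a geodesic ray. -/
theorem Connected.exists_injective_ray [Infinite V] {G : SimpleGraph V} (hG : G.Connected)
    (hfin : ∀ v, (G.neighborSet v).Finite) (x : V) :
    ∃ γ : ℕ → V, γ 0 = x ∧ (∀ n, G.Adj (γ n) (γ (n + 1))) ∧ Function.Injective γ := by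
  -- `A v` consists of the vertices `w` for which `v` lies on a geodesic from `x` to `w`.
  let A : V → Set V := fun v => {w | G.dist x w = G.dist x v + G.dist v w}
  -- König's argument: apart from `v`, the set `A v` is covered by the sets `A u` of the finitely
  -- many neighbours `u` of `v` one step further from `x`, so one of these is infinite as well.
  have step (v : {v // (A v).Infinite}) :
      ∃ v' : {v // (A v).Infinite}, G.Adj v v' ∧ G.dist x v' = G.dist x v + 1 := by
    obtain ⟨v, hv⟩ := v
    have hsub : A v \ {v} ⊆ ⋃ v' ∈ {u ∈ G.neighborSet v | G.dist x u = G.dist x v + 1}, A v' := by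
      rintro w ⟨hw, hwv : w ≠ v⟩
      obtain ⟨p, hp⟩ := hG.exists_walk_length_eq_dist v w
      cases p with
      | nil => exact absurd rfl hwv
      | @cons _ u _ hadj p =>
        have h1 : G.dist u w ≤ p.length := dist_le p
        have h2 : p.length + 1 = G.dist v w := by simpa using hp
        have h3 : G.dist x w ≤ G.dist x u + G.dist u w := hG.dist_triangle
        have h4 : G.dist x u ≤ G.dist x v + G.dist v u := hG.dist_triangle
        have h5 : G.dist v u = 1 := dist_eq_one_iff_adj.2 hadj
        have h6 : G.dist x w = G.dist x v + G.dist v w := hw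
        refine Set.mem_biUnion (x := u) ⟨hadj, by omega⟩ ?_
        change G.dist x w = G.dist x u + G.dist u w
        omega
    have hinf : (⋃ v' ∈ {u ∈ G.neighborSet v | G.dist x u = G.dist x v + 1}, A v').Infinite :=
      (hv.sdiff (Set.finite_singleton v)).mono hsub
    by_contra! hcon
    refine hinf (((hfin v).subset (Set.sep_subset _ _)).biUnion fun u hu => ?_)
    by_contra hu'
    exact hcon ⟨u, hu'⟩ hu.1 hu.2
  choose s hs1 hs2 using step
  have hx : (A x).Infinite := by
    have : A x = Set.univ := Set.eq_univ_of_forall fun w => by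
      change G.dist x w = G.dist x x + G.dist x w
      simp
    rw [this]
    exact Set.infinite_univ
  let γ : ℕ → {v // (A v).Infinite} := fun n => s^[n] ⟨x, hx⟩
  have hγ (n : ℕ) : γ (n + 1) = s (γ n) := Function.iterate_succ_apply' _ _ _
  have hdist (n : ℕ) : G.dist x (γ n) = n := by
    induction n with
    | zero => simp [γ]
    | succ n ih => rw [hγ, hs2, ih]
  refine ⟨fun n => γ n, rfl, fun n => ?_, fun a b hab => ?_⟩
  · dsimp only
    rw [hγ]
    exact hs1 _
  · have : G.dist x (γ a) = G.dist x (γ b) := congrArg (G.dist x) hab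
    rwa [hdist, hdist] at this

/-- A vertex of an infinite component of a locally finite graph is the origin of a ray. -/
theorem ConnectedComponent.exists_injective_ray {G : SimpleGraph V}
    (hfin : ∀ v, (G.neighborSet v).Finite) (C : G.ConnectedComponent) (hC : C.supp.Infinite)
    {x : V} (hx : x ∈ C.supp) :
    ∃ γ : ℕ → V, γ 0 = x ∧ (∀ n, G.Adj (γ n) (γ (n + 1))) ∧ Function.Injective γ := by
  have : Infinite C := Set.infinite_coe_iff.2 hC
  have hfin' (v : C) : (C.toSimpleGraph.neighborSet v).Finite := by
    refine Set.Finite.of_finite_image ((hfin v.1).subset ?_)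
      (f := fun v : C => (v.1 : V)) fun a _ b _ hab => Subtype.ext hab
    rintro _ ⟨w, hw, rfl⟩
    exact hw
  obtain ⟨γ, h0, h1, h2⟩ := C.connected_toSimpleGraph.exists_injective_ray hfin' ⟨x, hx⟩
  exact ⟨fun n => (γ n).1, by dsimp only; rw [h0], fun n => h1 n,
    fun a b hab => h2 (Subtype.ext hab)⟩

/-- A vertex of an infinite component of the complement of `S` is the origin of a ray in the
complement of `S`. -/
theorem exists_injective_ray_compl {G : SimpleGraph V} (hfin : ∀ v, (G.neighborSet v).Finite)
    {S : Set V} (C : G.ComponentCompl S) (hC : C.supp.Infinite) {x : V} (hx : x ∈ C.supp) :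
    ∃ γ : ℕ → V, γ 0 = x ∧ (∀ n, G.Adj (γ n) (γ (n + 1))) ∧ Function.Injective γ ∧
      ∀ n, γ n ∉ S := by
  obtain ⟨hxS, hxC⟩ := hx
  have hinf : (ConnectedComponent.supp C).Infinite := by
    refine Set.Infinite.of_image (fun v : ↥Sᶜ => (v : V)) (hC.mono ?_)
    rintro v ⟨hv, hvC⟩
    exact ⟨⟨v, hv⟩, hvC, rfl⟩
  have hfin' (v : ↥Sᶜ) : ((G.induce Sᶜ).neighborSet v).Finite := by
    refine Set.Finite.of_finite_image ((hfin v.1).subset ?_)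
      (f := fun v : ↥Sᶜ => (v : V)) fun a _ b _ hab => Subtype.ext hab
    rintro _ ⟨w, hw, rfl⟩
    exact hw
  obtain ⟨γ, h0, h1, h2⟩ :=
    ConnectedComponent.exists_injective_ray hfin' C hinf (x := ⟨x, hxS⟩) hxC
  exact ⟨fun n => (γ n).1, by dsimp only; rw [h0], fun n => h1 n,
    fun a b hab => h2 (Subtype.ext hab), fun n => (γ n).2⟩

/-- In a connected infinite locally finite graph there is a family of rays, one from each vertex,
which together pass through each vertex finitely often. -/
theorem Connected.exists_locallyFinite_rays [Countable V] [Infinite V] {G : SimpleGraph V}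
    (hG : G.Connected) (hfin : ∀ v, (G.neighborSet v).Finite) :
    ∃ γ : V → ℕ → V, (∀ x, γ x 0 = x) ∧ (∀ x n, G.Adj (γ x n) (γ x (n + 1))) ∧
      ∀ y, {t : V × ℕ | γ t.1 t.2 = y}.Finite := by
  classical
  have : Encodable V := Encodable.ofCountable V
  have : G.LocallyFinite := fun v => (hfin v).fintype
  have : Fact G.Preconnected := ⟨hG.preconnected⟩
  have hS (n : ℕ) : {v : V | Encodable.encode v < n}.Finite :=
    (Set.finite_lt_nat n).preimage Encodable.encode_injective.injOn
  let S : ℕ → Finset V := fun n => (hS n).toFinset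
  have memS (n : ℕ) (v : V) : v ∈ S n ↔ Encodable.encode v < n := by simp [S]
  -- From such an `x` one can escape to infinity without meeting the first `n` vertices of the
  -- enumeration.
  let good : ℕ → V → Prop := fun n x =>
    ∃ C : G.ComponentCompl (S n), C.supp.Infinite ∧ x ∈ C.supp
  -- Removing a finite set from a connected locally finite graph leaves finitely many components, so
  -- the finite ones contain finitely many vertices in all.
  have hbad (n : ℕ) : {x | ¬ good n x}.Finite := by
    have hsub : {x | ¬ good n x} ⊆ (S n : Set V) ∪
        ⋃ C ∈ {C : G.ComponentCompl (S n) | C.supp.Finite}, C.supp := by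
      intro x hx
      by_cases hxS : x ∈ (S n : Set V)
      · exact Or.inl hxS
      · refine Or.inr (Set.mem_biUnion (x := G.componentComplMk hxS) ?_
          (G.componentComplMk_mem hxS))
        by_contra hinf
        exact hx ⟨_, hinf, G.componentComplMk_mem hxS⟩
    have : Finite (G.ComponentCompl (S n)) := G.componentCompl_finite (S n)
    exact ((S n).finite_toSet.union ((Set.toFinite _).biUnion fun C hC => hC)).subset hsub
  -- `S 0` is empty, so its complement is the whole connected graph. This starts the search for the
  -- greatest good index below.
  have good_zero (x : V) : good 0 x := by
    have hx : x ∉ (S 0 : Set V) := by simp [memS]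
    refine ⟨G.componentComplMk hx, ?_, G.componentComplMk_mem hx⟩
    have : (G.componentComplMk hx).supp = Set.univ := by
      refine Set.eq_univ_of_forall fun v => ?_
      obtain ⟨p⟩ := hG.preconnected x v
      by_contra hv
      obtain ⟨d, -, hd1, hd2⟩ := p.exists_boundary_dart _ (G.componentComplMk_mem hx) hv
      exact hd2 (ComponentCompl.mem_of_adj (C := G.componentComplMk hx) _ _ hd1
        (by simp [memS]) d.adj)
    rw [this]
    exact Set.infinite_univ
  -- The ray from `x` avoids `S k` for the greatest good `k ≤ encode x`, hence every smaller `S k`.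
  -- The bound `encode x` makes the greatest index exist and tends to infinity with `x`.
  have ray (x : V) : ∃ γ : ℕ → V, γ 0 = x ∧ (∀ n, G.Adj (γ n) (γ (n + 1))) ∧
      Function.Injective γ ∧ ∀ k, k ≤ Encodable.encode x → good k x → ∀ n, γ n ∉ S k := by
    obtain ⟨C, hC, hx⟩ := Nat.findGreatest_spec (P := fun k => good k x)
      (Nat.zero_le (Encodable.encode x)) (good_zero x)
    obtain ⟨γ, h0, h1, h2, h3⟩ := exists_injective_ray_compl hfin C hC hx
    refine ⟨γ, h0, h1, h2, fun k hk hgood n hn => h3 n ?_⟩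
    have hle := Nat.le_findGreatest (P := fun k => good k x) hk hgood
    exact (memS _ _).2 (((memS _ _).1 hn).trans_le hle)
  choose γ h0 h1 h2 h3 using ray
  refine ⟨γ, h0, h1, fun y => ?_⟩
  -- The least index with `y ∈ S k`: a ray through `y` starts either at one of the first `k`
  -- vertices or at a vertex that is bad for `k`. Injectivity allows each such ray a single visit.
  let k := Encodable.encode y + 1
  refine Set.Finite.of_finite_image (f := Prod.fst)
    (((S k).finite_toSet.union (hbad k)).subset ?_) ?_
  · rintro _ ⟨⟨x, n⟩, hxn : γ x n = y, rfl⟩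
    by_contra hx
    simp only [Set.mem_union, Finset.mem_coe, memS, not_or, Set.mem_ofPred_eq, not_not] at hx
    refine h3 x k (not_lt.1 hx.1) hx.2 n ?_
    rw [hxn, memS]
    exact Nat.lt_succ_self _
  · rintro ⟨x, n⟩ hxn ⟨x', n'⟩ hxn' (rfl : x = x')
    exact Prod.ext rfl (h2 x (Eq.trans hxn (Eq.symm hxn')))

end SimpleGraph

/-! ### Partial isometries between orthonormal families -/

namespace Orthonormal

variable {T H : Type*} [NormedAddCommGroup H] [InnerProductSpace ℂ H] [CompleteSpace H]
  {ψ ψ' ψ'' : T → H}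

/-- The isometry `ℓ²(T) → H` which takes the standard basis to the orthonormal family `ψ`. -/
noncomputable def synthesis (h : Orthonormal ℂ ψ) : lp (fun _ : T => ℂ) 2 →L[ℂ] H :=
  h.orthogonalFamily.linearIsometry.toContinuousLinearMap

theorem hasSum_synthesis (h : Orthonormal ℂ ψ) (a : lp (fun _ : T => ℂ) 2) :
    HasSum (fun t => a t • ψ t) (h.synthesis a) :=
  h.orthogonalFamily.hasSum_linearIsometry a

theorem synthesis_single [DecidableEq T] (h : Orthonormal ℂ ψ) (t : T) :
    h.synthesis (lp.single 2 t (1 : ℂ)) = ψ t := by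
  exact (h.orthogonalFamily.linearIsometry_apply_single (i := t) (1 : ℂ)).trans (by simp)

theorem adjoint_synthesis_comp_synthesis (h : Orthonormal ℂ ψ) :
    h.synthesis.adjoint ∘L h.synthesis = 1 :=
  (ContinuousLinearMap.norm_map_iff_adjoint_comp_self _).1
    h.orthogonalFamily.linearIsometry.norm_map

theorem adjoint_synthesis_apply (h : Orthonormal ℂ ψ) (x : H) (t : T) :
    h.synthesis.adjoint x t = inner ℂ (ψ t) x := by
  classical
  have h1 := lp.inner_single_left (𝕜 := ℂ) (G := fun _ : T => ℂ) t 1 (h.synthesis.adjoint x)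
  rw [ContinuousLinearMap.adjoint_inner_right, h.synthesis_single] at h1
  simpa using h1.symm

/-- The partial isometry which takes the orthonormal family `ψ` to the orthonormal family `ψ'`
and vanishes on the orthogonal complement of `ψ`. -/
noncomputable def transfer (h : Orthonormal ℂ ψ) (h' : Orthonormal ℂ ψ') : H →L[ℂ] H :=
  h'.synthesis ∘L h.synthesis.adjoint

theorem hasSum_transfer (h : Orthonormal ℂ ψ) (h' : Orthonormal ℂ ψ') (x : H) :
    HasSum (fun t => inner ℂ (ψ t) x • ψ' t) (transfer h h' x) := by
  have := h'.hasSum_synthesis (h.synthesis.adjoint x)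
  simp only [adjoint_synthesis_apply] at this
  exact this

theorem star_transfer (h : Orthonormal ℂ ψ) (h' : Orthonormal ℂ ψ') :
    star (transfer h h') = transfer h' h := by
  rw [ContinuousLinearMap.star_eq_adjoint, transfer, ContinuousLinearMap.adjoint_comp,
    ContinuousLinearMap.adjoint_adjoint, transfer]

theorem transfer_mul_transfer (h : Orthonormal ℂ ψ) (h' : Orthonormal ℂ ψ')
    (h'' : Orthonormal ℂ ψ'') : transfer h' h'' * transfer h h' = transfer h h'' := by
  ext x
  exact congrArg h''.synthesis
    (DFunLike.congr_fun h'.adjoint_synthesis_comp_synthesis (h.synthesis.adjoint x))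

/-- The range of the right factor is spanned by `χ'`, on which all coefficients against `ψ` vanish.
This gives `v* w = 0` in the swindle. -/
theorem transfer_mul_transfer_eq_zero {T' : Type*} {χ χ' : T' → H} (h : Orthonormal ℂ ψ)
    (h' : Orthonormal ℂ ψ') (k : Orthonormal ℂ χ) (k' : Orthonormal ℂ χ')
    (hort : ∀ t s, inner ℂ (ψ t) (χ' s) = 0) : transfer h h' * transfer k k' = 0 := by
  ext x
  have h0 : h.synthesis.adjoint (transfer k k' x) = 0 := by
    ext t
    rw [adjoint_synthesis_apply]
    have h1 := (hasSum_transfer k k' x).mapL (innerSL ℂ (ψ t))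
    simp only [innerSL_apply_apply, inner_smul_right, hort, mul_zero] at h1
    exact h1.unique hasSum_zero
  change h'.synthesis (h.synthesis.adjoint (transfer k k' x)) = 0
  rw [h0, map_zero]

theorem transfer_self (h : Orthonormal ℂ ψ) :
    transfer h h = (Submodule.span ℂ (Set.range ψ)).topologicalClosure.starProjection := by
  ext x
  refine (Submodule.eq_starProjection_of_mem_orthogonal ?_ ?_).symm
  · exact mem_closure_of_tendsto (hasSum_transfer h h x) (Filter.Eventually.of_forall fun s =>
      sum_mem fun t _ => Submodule.smul_mem _ _ (Submodule.subset_span ⟨t, rfl⟩))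
  · rw [Submodule.orthogonal_closure, Submodule.mem_orthogonal]
    intro u hu
    induction hu using Submodule.span_induction with
    | mem u hu =>
      obtain ⟨t, rfl⟩ := hu
      have h1 := h.adjoint_synthesis_apply (transfer h h x) t
      have h2 : h.synthesis.adjoint (transfer h h x) = h.synthesis.adjoint x :=
        DFunLike.congr_fun h.adjoint_synthesis_comp_synthesis (h.synthesis.adjoint x)
      rw [h2, h.adjoint_synthesis_apply] at h1
      rw [inner_sub_right, h1, sub_self]
    | zero => simp
    | add u v _ _ hu hv => rw [inner_add_left, hu, hv, add_zero]
    | smul c u _ hu => rw [inner_smul_left, hu, mul_zero]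

/-- The expansion along `ψ` splits according to the decomposition of the index set. This gives `v v*
+ w w* = q` in the swindle. -/
theorem transfer_add_transfer {T₁ T₂ : Type*} (h : Orthonormal ℂ ψ) (e : T₁ ⊕ T₂ ≃ T)
    {ψ₁ : T₁ → H} {ψ₂ : T₂ → H} (h₁ : Orthonormal ℂ ψ₁) (h₂ : Orthonormal ℂ ψ₂)
    (e₁ : ∀ t, ψ (e (Sum.inl t)) = ψ₁ t) (e₂ : ∀ t, ψ (e (Sum.inr t)) = ψ₂ t) :
    transfer h₁ h₁ + transfer h₂ h₂ = transfer h h := by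
  refine ContinuousLinearMap.ext fun x => ?_
  refine HasSum.unique (HasSum.sum (f := fun t => inner ℂ (ψ (e t)) x • ψ (e t)) ?_ ?_)
    (e.hasSum_iff.2 (hasSum_transfer h h x))
  · have := hasSum_transfer h₁ h₁ x
    simp only [← e₁] at this
    exact this
  · have := hasSum_transfer h₂ h₂ x
    simp only [← e₂] at this
    exact this

end Orthonormal

/-- Gram–Schmidt applied to a sequence from a Hamel basis stays inside `K`, so `K` need not be
closed; this matters for ranges of multiplication operators. -/
theorem Orthonormal.exists_nat_of_not_finiteDimensional {H : Type*} [NormedAddCommGroup H]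
    [InnerProductSpace ℂ H] {K : Submodule ℂ H}
    (hK : ¬ FiniteDimensional ℂ K) :
    ∃ e : ℕ → H, Orthonormal ℂ e ∧ ∀ n, e n ∈ K := by
  let b := Module.Basis.ofVectorSpace ℂ K
  have : Infinite (Module.Basis.ofVectorSpaceIndex ℂ K) := by
    by_contra hfin
    rw [not_infinite_iff_finite] at hfin
    exact hK (Module.Finite.of_basis b)
  have hli := b.linearIndependent.comp _
    (Infinite.natEmbedding (Module.Basis.ofVectorSpaceIndex ℂ K)).injective
  have hon := InnerProductSpace.gramSchmidtNormed_orthonormal hli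
  exact ⟨_, hon.comp_linearIsometry K.subtypeₗᵢ, fun n => Subtype.mem _⟩

/-! ### Finite-rank operators are compact -/

namespace IsCompactOperator

variable {E F : Type*} [NormedAddCommGroup E] [NormedSpace ℂ E] [NormedAddCommGroup F]
  [NormedSpace ℂ F]

theorem smulRight (l : E →L[ℂ] ℂ) (v : F) : IsCompactOperator (l.smulRight v) := by
  refine ⟨(fun z : ℂ => z • v) '' Metric.closedBall 0 1,
    (isCompact_closedBall _ _).image (by fun_prop), ?_⟩
  have h : l ⁻¹' Metric.closedBall 0 1 ∈ 𝓝 (0 : E) :=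
    l.continuous.continuousAt.preimage_mem_nhds (by
      rw [map_zero]; exact Metric.closedBall_mem_nhds _ one_pos)
  exact Filter.mem_of_superset h fun x hx => ⟨l x, hx, rfl⟩

theorem of_finiteDimensional_range (A : E →L[ℂ] F)
    (h : FiniteDimensional ℂ (LinearMap.range (A : E →ₗ[ℂ] F))) : IsCompactOperator A := by
  have h1 : IsCompactOperator (id : LinearMap.range (A : E →ₗ[ℂ] F) → _) :=
    isCompactOperator_id_iff_finiteDimensional.2 h
  let B : E →L[ℂ] LinearMap.range (A : E →ₗ[ℂ] F) :=
    A.codRestrict _ fun x => LinearMap.mem_range_self (A : E →ₗ[ℂ] F) x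
  exact (h1.comp_clm B).clm_comp (LinearMap.range (A : E →ₗ[ℂ] F)).subtypeL

theorem finset_sum {ι : Type*} (s : Finset ι) {A : ι → E →L[ℂ] F}
    (h : ∀ i ∈ s, IsCompactOperator (A i)) : IsCompactOperator (∑ i ∈ s, A i : E →L[ℂ] F) := by
  classical
  induction s using Finset.induction_on with
  | empty => simpa using isCompactOperator_zero
  | insert i s hi ih =>
    rw [Finset.sum_insert hi]
    exact (h i (Finset.mem_insert_self i s)).add
      (ih fun j hj => h j (Finset.mem_insert_of_mem hj))

end IsCompactOperator

/-! ### Localized families and the Roe algebra -/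

namespace RoeAlgebra

theorem inner_eq_zero_of_ae {X : Type*} [MeasurableSpace X] {m : Measure X}
    {ξ η : L2 m} (h : ∀ᵐ x ∂m, ξ x = 0 ∨ η x = 0) :
    inner ℂ ξ η = (0 : ℂ) := by
  rw [L2.inner_def]
  refine integral_eq_zero_of_ae ?_
  filter_upwards [h] with x hx
  rcases hx with hx | hx <;> simp [hx]

variable {X : Type*} [MetricSpace X]

/-- A continuous function on `X`, which vanishes exactly off the open ball of radius `r` around
`x₀`, and equals `1` on the ball of radius `r - 1`. -/
noncomputable def bump [ProperSpace X] (x₀ : X) (r : ℝ) : C₀(X, ℂ) where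
  toFun x := ((max 0 (min 1 (r - dist x x₀)) : ℝ) : ℂ)
  continuous_toFun := by fun_prop
  zero_at_infty' := by
    refine tendsto_const_nhds.congr' ?_
    have : (Metric.closedBall x₀ r)ᶜ ∈ Filter.cocompact X :=
      (isCompact_closedBall x₀ r).compl_mem_cocompact
    filter_upwards [this] with x hx
    have hx' : r < dist x x₀ := by simpa using hx
    rw [max_eq_left ((min_le_right _ _).trans (by linarith)), Complex.ofReal_zero]

theorem bump_apply [ProperSpace X] (x₀ : X) (r : ℝ) (x : X) :
    bump x₀ r x = ((max 0 (min 1 (r - dist x x₀)) : ℝ) : ℂ) := rfl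

theorem bump_eq_zero_iff [ProperSpace X] {x₀ : X} {r : ℝ} {x : X} :
    bump x₀ r x = 0 ↔ r ≤ dist x x₀ := by
  rw [bump_apply, Complex.ofReal_eq_zero, max_eq_left_iff, min_le_iff]
  constructor
  · rintro (h | h) <;> linarith
  · intro h
    right
    linarith

/-- Functions of bounded support are dense in `C₀(X)`. -/
theorem dense_boundedSupport [ProperSpace X] (x₀ : X) :
    Dense {g : C₀(X, ℂ) | ∃ r : ℝ, ∀ x, g x ≠ 0 → dist x x₀ ≤ r} := by
  intro f
  refine Metric.mem_closure_iff.2 fun ε hε => ?_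
  have hf : ∀ᶠ x in Filter.cocompact X, ‖f x‖ < ε / 2 := by
    have := (zero_at_infty f).norm
    rw [norm_zero] at this
    exact this.eventually_lt_const (by positivity)
  rw [← Metric.cobounded_eq_cocompact] at hf
  obtain ⟨r, -, hr⟩ := (Metric.hasBasis_cobounded_compl_closedBall x₀).eventually_iff.1 hf
  -- The radius is `r + 1` because this cutoff equals `1` on the ball of radius `r`; outside that
  -- ball `f` is already small.
  refine ⟨f * bump x₀ (r + 1), ⟨r + 1, fun x hx => ?_⟩, ?_⟩
  · by_contra! h
    exact hx (by rw [ZeroAtInftyContinuousMap.mul_apply, bump_eq_zero_iff.2 h.le, mul_zero])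
  · refine lt_of_le_of_lt ?_ (half_lt_self hε)
    rw [← ZeroAtInftyContinuousMap.dist_toBCF_eq_dist,
      BoundedContinuousFunction.dist_le (by positivity)]
    intro x
    change dist (f x) (f x * bump x₀ (r + 1) x) ≤ ε / 2
    rw [dist_eq_norm, ← mul_one_sub, norm_mul, bump_apply, ← Complex.ofReal_one,
      ← Complex.ofReal_sub, Complex.norm_real, Real.norm_eq_abs]
    by_cases hx : dist x x₀ ≤ r
    · rw [min_eq_left (by linarith), max_eq_right zero_le_one, sub_self, abs_zero, mul_zero]
      positivity
    · have h1 : ‖f x‖ < ε / 2 := hr (by simpa using hx)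
      have h2 : |1 - max 0 (min 1 (r + 1 - dist x x₀))| ≤ 1 := by
        rw [abs_le]
        constructor
        · linarith [max_le zero_le_one (min_le_left (1 : ℝ) (r + 1 - dist x x₀))]
        · linarith [le_max_left 0 (min (1 : ℝ) (r + 1 - dist x x₀))]
      calc ‖f x‖ * |1 - max 0 (min 1 (r + 1 - dist x x₀))| ≤ ‖f x‖ * 1 := by gcongr
        _ ≤ ε / 2 := by linarith

variable [MeasurableSpace X] {m : Measure X}

/-- Orthonormal functions `ψ t` in `L²(X)` supported in balls of radius `R` around points `c t`, of
which only finitely many lie in any given ball. -/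
structure IsLocalized {T : Type*} (R : ℝ) (c : T → X) (ψ : T → L2 m) : Prop where
  orthonormal : Orthonormal ℂ ψ
  eq_zero : ∀ t, ∀ᵐ x ∂m, R < dist x (c t) → ψ t x = 0
  finite : ∀ x r, {t | dist (c t) x ≤ r}.Finite

namespace IsLocalized

variable {T : Type*} {R : ℝ} {c : T → X} {ψ : T → L2 m}

theorem comp (h : IsLocalized R c ψ) {T' : Type*} {i : T' → T} (hi : Function.Injective i) :
    IsLocalized R (fun t => c (i t)) (fun t => ψ (i t)) where
  orthonormal := h.orthonormal.comp i hi
  eq_zero t := h.eq_zero (i t)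
  finite x r := (h.finite x r).preimage hi.injOn

theorem ae_eq_zero (h : IsLocalized R c ψ) {f : C₀(X, ℂ)} {t : T}
    (hf : ∀ x, f x ≠ 0 → R < dist x (c t)) : ∀ᵐ x ∂m, f x ≠ 0 → ψ t x = 0 := by
  filter_upwards [h.eq_zero t] with x hx hfx
  exact hx (hf x hfx)

theorem finite_not_ae_eq_zero (h : IsLocalized R c ψ) {f : C₀(X, ℂ)} {x₀ : X} {r : ℝ}
    (hf : ∀ x, f x ≠ 0 → dist x x₀ ≤ r) : {t | ¬ ∀ᵐ x ∂m, f x ≠ 0 → ψ t x = 0}.Finite := by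
  refine (h.finite x₀ (r + R)).subset fun t ht => ?_
  change dist (c t) x₀ ≤ r + R
  by_contra! hlt
  refine ht (h.ae_eq_zero fun x hx => ?_)
  linarith [hf x hx, dist_triangle_left (c t) x₀ x]

end IsLocalized

variable [BorelSpace X]

theorem mulOp_eq_zero_iff {f : C₀(X, ℂ)} {ξ : L2 m} :
    mulOp m f ξ = 0 ↔ ∀ᵐ x ∂m, f x ≠ 0 → ξ x = 0 := by
  rw [Lp.eq_zero_iff_ae_eq_zero]
  refine ⟨fun h => ?_, fun h => ?_⟩
  · filter_upwards [h, mulOp_coeFn m f ξ] with x hx hx' hf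
    rw [hx'] at hx
    exact (mul_eq_zero.1 hx).resolve_left hf
  · filter_upwards [h, mulOp_coeFn m f ξ] with x hx hx'
    rw [hx']
    by_cases hf : f x = 0
    · simp [hf]
    · simp [hx hf]

theorem inner_mulOp_eq_zero {f : C₀(X, ℂ)} {ξ : L2 m} (h : ∀ᵐ x ∂m, f x ≠ 0 → ξ x = 0)
    (η : L2 m) : inner ℂ ξ (mulOp m f η) = (0 : ℂ) := by
  refine inner_eq_zero_of_ae ?_
  filter_upwards [h, mulOp_coeFn m f η] with x hx hx'
  by_cases hf : f x = 0
  · right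
    rw [hx', hf, zero_mul]
  · exact Or.inl (hx hf)

/-- Lets compactness of products with multiplication operators pass from functions of bounded
support to all of `C₀(X)`. -/
theorem continuous_mulOp : Continuous (mulOp m) := by
  refine (LipschitzWith.of_dist_le_mul (K := 1) fun f g => ?_).continuous
  rw [NNReal.coe_one, one_mul, dist_eq_norm]
  refine ContinuousLinearMap.opNorm_le_bound _ dist_nonneg fun ξ => ?_
  refine Lp.norm_le_mul_norm_of_ae_le_mul ?_
  rw [sub_apply]
  filter_upwards [mulOp_coeFn m f ξ, mulOp_coeFn m g ξ,
    Lp.coeFn_sub (mulOp m f ξ) (mulOp m g ξ)] with x h1 h2 h3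
  rw [h3, Pi.sub_apply, h1, h2, ← sub_mul, norm_mul]
  gcongr
  rw [← dist_eq_norm, ← ZeroAtInftyContinuousMap.dist_toBCF_eq_dist]
  exact BoundedContinuousFunction.dist_coe_le_dist (f := f.toBCF) (g := g.toBCF) x

namespace IsLocalized

variable {T : Type*} {R R' : ℝ} {c c' : T → X} {ψ ψ' : T → L2 m}

theorem hasFinitePropagation_transfer (h : IsLocalized R c ψ) (h' : IsLocalized R' c' ψ') {K : ℝ}
    (hK : ∀ t, dist (c t) (c' t) ≤ K) :
    HasFinitePropagation m (h.orthonormal.transfer h'.orthonormal) := by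
  -- If `ψ t` meets the support of `g` and `ψ' t` that of `f`, these supports come within `R + R' +
  -- K`. The `1` only ensures positivity.
  refine ⟨max 1 (R + R' + K), lt_max_of_lt_left one_pos, fun f g hfg => ?_⟩
  ext1 ξ
  refine ((h.orthonormal.hasSum_transfer h'.orthonormal (mulOp m g ξ)).mapL (mulOp m f)).unique ?_
  suffices h0 : ∀ t, mulOp m f (inner ℂ (ψ t) (mulOp m g ξ) • ψ' t) = 0 by
    simp only [h0]
    exact hasSum_zero
  intro t
  rw [map_smul]
  by_cases hf : ∀ x, f x ≠ 0 → R' < dist x (c' t)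
  · rw [mulOp_eq_zero_iff.2 (h'.ae_eq_zero hf), smul_zero]
  · rw [inner_mulOp_eq_zero (h.ae_eq_zero ?_), zero_smul]
    push Not at hf
    obtain ⟨x, hx, hxR⟩ := hf
    intro y hy
    have h1 : max 1 (R + R' + K) < dist x y := hfg x (subset_tsupport f hx) y (subset_tsupport g hy)
    have h2 : R + R' + K < dist x y := (le_max_right _ _).trans_lt h1
    have h3 := dist_triangle4 x (c' t) (c t) y
    rw [dist_comm (c' t), dist_comm (c t) y] at h3
    linarith [hK t]

variable [ProperSpace X]

/-- A function of bounded support meets only finitely many `ψ t`, so the product has finite rank.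
Density of such functions and closedness of the compact operators do the rest. -/
theorem isCompactOperator_transfer_comp (h : IsLocalized R c ψ) (h' : Orthonormal ℂ ψ')
    (f : C₀(X, ℂ)) : IsCompactOperator (h.orthonormal.transfer h' ∘L mulOp m f) := by
  rcases isEmpty_or_nonempty X with hX | ⟨⟨x₀⟩⟩
  · have h0 : mulOp m f = 0 := by
      ext1 ξ
      exact mulOp_eq_zero_iff.2 (Filter.Eventually.of_forall fun x => isEmptyElim x)
    rw [h0, ContinuousLinearMap.comp_zero]
    exact isCompactOperator_zero
  let P : C₀(X, ℂ) → Prop := fun f => IsCompactOperator (h.orthonormal.transfer h' ∘L mulOp m f)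
  have hcl : IsClosed {f | P f} :=
    (isClosed_setOfPred_isCompactOperator (𝕜₁ := ℂ) (σ₁₂ := RingHom.id ℂ)).preimage
      ((ContinuousLinearMap.compL ℂ (L2 m) (L2 m) (L2 m) (h.orthonormal.transfer h')).continuous.comp
        continuous_mulOp)
  refine hcl.closure_subset_iff.2 ?_ (dense_boundedSupport x₀ f)
  rintro g ⟨r, hg⟩
  have hfin := h.finite_not_ae_eq_zero hg
  have hsum : h.orthonormal.transfer h' ∘L mulOp m g
      = ∑ t ∈ hfin.toFinset, ((innerSL ℂ (ψ t)) ∘L mulOp m g).smulRight (ψ' t) := by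
    ext1 ξ
    refine (h.orthonormal.hasSum_transfer h' (mulOp m g ξ)).unique ?_
    rw [sum_apply]
    refine hasSum_sum_of_ne_finset_zero fun t ht => ?_
    have : ∀ᵐ x ∂m, g x ≠ 0 → ψ t x = 0 := by simpa using ht
    rw [inner_mulOp_eq_zero this, zero_smul]
  change IsCompactOperator _
  rw [hsum]
  exact IsCompactOperator.finset_sum _ fun t _ => IsCompactOperator.smulRight _ _

theorem isCompactOperator_comp_transfer (h : Orthonormal ℂ ψ) (h' : IsLocalized R c ψ')
    (f : C₀(X, ℂ)) : IsCompactOperator (mulOp m f ∘L h.transfer h'.orthonormal) := by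
  rcases isEmpty_or_nonempty X with hX | ⟨⟨x₀⟩⟩
  · have h0 : mulOp m f = 0 := by
      ext1 ξ
      exact mulOp_eq_zero_iff.2 (Filter.Eventually.of_forall fun x => isEmptyElim x)
    rw [h0, ContinuousLinearMap.zero_comp]
    exact isCompactOperator_zero
  let P : C₀(X, ℂ) → Prop := fun f => IsCompactOperator (mulOp m f ∘L h.transfer h'.orthonormal)
  have hcl : IsClosed {f | P f} :=
    (isClosed_setOfPred_isCompactOperator (𝕜₁ := ℂ) (σ₁₂ := RingHom.id ℂ)).preimage
      (((ContinuousLinearMap.compL ℂ (L2 m) (L2 m) (L2 m)).flip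
        (h.transfer h'.orthonormal)).continuous.comp continuous_mulOp)
  refine hcl.closure_subset_iff.2 ?_ (dense_boundedSupport x₀ f)
  rintro g ⟨r, hg⟩
  have hfin := h'.finite_not_ae_eq_zero hg
  have hsum : mulOp m g ∘L h.transfer h'.orthonormal
      = ∑ t ∈ hfin.toFinset, (innerSL ℂ (ψ t)).smulRight (mulOp m g (ψ' t)) := by
    ext1 ξ
    refine ((h.hasSum_transfer h'.orthonormal ξ).mapL (mulOp m g)).unique ?_
    simp only [map_smul]
    rw [sum_apply]
    refine hasSum_sum_of_ne_finset_zero fun t ht => ?_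
    have : ∀ᵐ x ∂m, g x ≠ 0 → ψ' t x = 0 := by simpa using ht
    rw [mulOp_eq_zero_iff.2 this, smul_zero]
  change IsCompactOperator _
  rw [hsum]
  exact IsCompactOperator.finset_sum _ fun t _ => IsCompactOperator.smulRight _ _

theorem transfer_mem_roeAlgebra (h : IsLocalized R c ψ) (h' : IsLocalized R' c' ψ') {K : ℝ}
    (hK : ∀ t, dist (c t) (c' t) ≤ K) :
    h.orthonormal.transfer h'.orthonormal ∈ roeAlgebra m :=
  subset_closure (NonUnitalStarAlgebra.subset_adjoin ℂ _
    ⟨fun f => ⟨h.isCompactOperator_transfer_comp h'.orthonormal f,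
      isCompactOperator_comp_transfer h.orthonormal h' f⟩,
      h.hasFinitePropagation_transfer h' hK⟩)

end IsLocalized

/-- If `L²(X)` is ample and the essential support of some function contains `x`, then there are
infinitely many orthonormal functions supported in any given ball around `x`. -/
theorem IsAmple.exists_orthonormal [ProperSpace X] (hm : IsAmple m) {ξ : L2 m} {x : X}
    (hx : x ∈ Wannier.essSupport ξ) {r : ℝ} (hr : 0 < r) :
    ∃ e : ℕ → L2 m, Orthonormal ℂ e ∧ ∀ n, ∀ᵐ y ∂m, r ≤ dist y x → e n y = 0 := by
  -- Otherwise every function, `ξ` included, would vanish almost everywhere on the ball around `x`,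
  -- against `x ∈ essSupport ξ`.
  have hne : mulOp m (bump x r) ≠ 0 := by
    intro h0
    refine hx (Metric.ball x r) Metric.isOpen_ball (Metric.mem_ball_self hr) ?_
    filter_upwards [mulOp_eq_zero_iff.1 (DFunLike.congr_fun h0 ξ)] with y hy hyr
    exact hy (bump_eq_zero_iff.not.2 (not_le.2 hyr))
  obtain ⟨e, he, hmem⟩ := Orthonormal.exists_nat_of_not_finiteDimensional
    (K := LinearMap.range (mulOp m (bump x r) : L2 m →ₗ[ℂ] L2 m))
    fun hfin => hne (hm _ (IsCompactOperator.of_finiteDimensional_range _ hfin))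
  refine ⟨e, he, fun n => ?_⟩
  obtain ⟨η, hη⟩ := hmem n
  filter_upwards [mulOp_coeFn m (bump x r) η] with y hy hyr
  rw [← hη]
  exact hy.trans (by rw [bump_eq_zero_iff.2 hyr, zero_mul])

end RoeAlgebra

/-! ### Coarse rays in `D` and functions localized along them -/

namespace Wannier

open RoeAlgebra

variable {X : Type*} [MetricSpace X]

/-- A compact ball has a finite `ε / 2`-net, and each point of the net is within `ε / 2` of at most
one point of `D`. -/
theorem UniformlyDiscrete.finite_dist_le [ProperSpace X] {D : Set X}
    (hD : UniformlyDiscrete D) (x : X) (r : ℝ) : {y : D | dist (y : X) x ≤ r}.Finite := by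
  obtain ⟨ε, hε, hsep⟩ := hD
  obtain ⟨s, hs, hcover⟩ := Metric.totallyBounded_iff.1
    (isCompact_closedBall x r).totallyBounded (ε / 2) (half_pos hε)
  have hnet (y : {y : D | dist (y : X) x ≤ r}) : ∃ z : s, dist (y : X) z < ε / 2 := by
    simpa using hcover (Metric.mem_closedBall.2 y.2)
  choose f hf using hnet
  have : Finite s := hs
  refine Set.finite_coe_iff.1 (Finite.of_injective f fun a b hab => ?_)
  by_contra hne
  have h1 : ε ≤ dist (a : X) b := hsep _ a.1.2 _ b.1.2 fun h => hne (Subtype.ext (Subtype.ext h))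
  have h2 := dist_triangle_right (a : X) b (f a)
  have h3 := hf a
  have h4 := hf b
  rw [← hab] at h4
  linarith

theorem UniformlyDiscrete.countable [ProperSpace X] {D : Set X} (hD : UniformlyDiscrete D) :
    Countable D := by
  rcases isEmpty_or_nonempty X with hX | ⟨⟨x₀⟩⟩
  · infer_instance
  refine Set.countable_univ_iff.1 (Set.Countable.mono (fun y _ => ?_)
    (Set.countable_iUnion fun n : ℕ => (hD.finite_dist_le x₀ n).countable))
  obtain ⟨n, hn⟩ := exists_nat_ge (dist (y : X) x₀)
  exact Set.mem_iUnion.2 ⟨n, hn⟩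

theorem CoarselyDense.infinite [ProperSpace X] [NoncompactSpace X] {D : Set X}
    (hD : CoarselyDense D) : Infinite D := by
  obtain ⟨C, -, hC⟩ := hD
  by_contra hfin
  rw [not_infinite_iff_finite] at hfin
  refine noncompact_univ X ((isCompact_iUnion fun y : D => isCompact_closedBall (y : X) C)
    |>.of_isClosed_subset isClosed_univ fun x _ => ?_)
  obtain ⟨y, hy, hxy⟩ := hC x
  exact Set.mem_iUnion.2 ⟨⟨y, hy⟩, hxy.le⟩

/-- The graph on `D` in which distinct points at distance less than `K` are adjacent. -/
def proximityGraph (D : Set X) (K : ℝ) : SimpleGraph D where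
  Adj x y := x ≠ y ∧ dist (x : X) y < K
  symm := ⟨fun x y h => ⟨h.1.symm, by rw [dist_comm]; exact h.2⟩⟩
  loopless := ⟨fun _ h => h.1 rfl⟩

/-- The balls of radius `C` around a component of the graph and those around its complement are
disjoint open sets covering `X`: centers of overlapping balls are equal or adjacent. -/
theorem connected_proximityGraph [PreconnectedSpace X] {D : Set X} [Nonempty D] {C : ℝ}
    (hC : ∀ x : X, ∃ y ∈ D, dist x y < C) : (proximityGraph D (2 * C)).Connected := by
  have hadj {x y : D} {z : X} (hx : dist z x < C) (hy : dist z y < C) :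
      (proximityGraph D (2 * C)).Reachable x y := by
    by_cases hxy : x = y
    · rw [hxy]
    · refine SimpleGraph.Adj.reachable ⟨hxy, ?_⟩
      linarith [dist_triangle_left (x : X) y z]
  have hpre : (proximityGraph D (2 * C)).Preconnected := by
    intro x y
    let U : Set X :=
      ⋃ w ∈ {w : D | (proximityGraph D (2 * C)).Reachable x w}, Metric.ball (w : X) C
    have hU : IsClopen U := by
      refine ⟨⟨?_⟩, isOpen_biUnion fun _ _ => Metric.isOpen_ball⟩
      have : Uᶜ = ⋃ w ∈ {w : D |
          ¬ (proximityGraph D (2 * C)).Reachable x w}, Metric.ball (w : X) C := by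
        ext z
        simp only [U, Set.mem_compl_iff, Set.mem_iUnion, Metric.mem_ball, Set.mem_ofPred_eq,
          not_exists, exists_prop, not_and]
        constructor
        · intro h
          obtain ⟨w, hw, hzw⟩ := hC z
          exact ⟨⟨w, hw⟩, fun hxw => h _ hxw hzw, hzw⟩
        · rintro ⟨w, hxw, hzw⟩ v hxv hzv
          exact hxw (hxv.trans (hadj hzv hzw))
      rw [this]
      exact isOpen_biUnion fun _ _ => Metric.isOpen_ball
    have hCpos : 0 < C := by
      obtain ⟨_, _, h⟩ := hC x
      exact dist_nonneg.trans_lt h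
    have hxU : (x : X) ∈ U := Set.mem_biUnion (x := x) (SimpleGraph.Reachable.refl x)
      (Metric.mem_ball_self hCpos)
    have hyU : (y : X) ∈ U := by
      rw [hU.eq_univ ⟨_, hxU⟩]
      trivial
    obtain ⟨w, hw, hyw⟩ := Set.mem_iUnion₂.1 hyU
    exact SimpleGraph.Reachable.trans hw (hadj hyw (by rwa [dist_self]))
  exact ⟨hpre⟩

/-- A uniformly discrete coarsely dense subset `D` of a connected non-compact proper space carries
a family of coarse rays, one from each point, of which only finitely many terms lie in any given
ball. -/
theorem exists_coarse_rays [ProperSpace X] [PreconnectedSpace X] [NoncompactSpace X] {D : Set X}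
    (hD : UniformlyDiscrete D) (hDX : CoarselyDense D) :
    ∃ (K : ℝ) (γ : D → ℕ → D), (∀ x, γ x 0 = x) ∧
      (∀ x n, dist (γ x n : X) (γ x (n + 1)) ≤ K) ∧
      ∀ (y : X) (r : ℝ), {t : D × ℕ | dist (γ t.1 t.2 : X) y ≤ r}.Finite := by
  have := hD.countable
  have := hDX.infinite
  obtain ⟨C, -, hC⟩ := hDX
  obtain ⟨γ, h0, hadj, hfin⟩ :=
    (connected_proximityGraph hC).exists_locallyFinite_rays fun v =>
      (hD.finite_dist_le (v : X) (2 * C)).subset fun w hw => by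
        change dist (w : X) v ≤ 2 * C
        rw [dist_comm]
        exact hw.2.le
  refine ⟨2 * C, γ, h0, fun x n => (hadj x n).2.le, fun y r => ?_⟩
  refine ((hD.finite_dist_le y r).biUnion fun w _ => hfin w).subset fun t ht => ?_
  exact Set.mem_biUnion (x := γ t.1 t.2) ht rfl

variable [MeasurableSpace X] {m : Measure X}

/-- The definition gives vanishing only near each point off the support; second countability reduces
to countably many null sets. -/
theorem ae_eq_zero_of_notMem_essSupport [SecondCountableTopology X] (ξ : L2 m) :
    ∀ᵐ x ∂m, x ∉ essSupport ξ → ξ x = 0 := by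
  rw [ae_iff]
  refine measure_null_of_locally_null _ fun x hx => ?_
  simp only [Set.mem_ofPred_eq, Classical.not_imp] at hx
  have hU := hx.1
  simp only [essSupport, Set.mem_ofPred_eq, not_forall, not_not] at hU
  obtain ⟨U, hUo, hxU, hU⟩ := hU
  refine ⟨_, inter_mem_nhdsWithin _ (hUo.mem_nhds hxU), ?_⟩
  refine measure_mono_null ?_ (ae_iff.1 hU)
  rintro y ⟨hy, hyU⟩
  simp only [Set.mem_ofPred_eq, Classical.not_imp] at hy ⊢
  exact ⟨hyU, hy.2⟩

theorem IsWannierBasis.exists_isLocalized [ProperSpace X] {D : Set X} {φ : D → L2 m}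
    (hφ : IsWannierBasis D φ) (hD : UniformlyDiscrete D) :
    ∃ R : ℝ, IsLocalized R (fun x : D => (x : X)) φ := by
  obtain ⟨C, hC⟩ := hφ.bounded
  refine ⟨C, ⟨hφ.norm_eq_one, fun x y hxy => inner_eq_zero_of_ae ?_⟩, fun x => ?_,
    hD.finite_dist_le⟩
  · filter_upwards [ae_eq_zero_of_notMem_essSupport (φ x),
      ae_eq_zero_of_notMem_essSupport (φ y)] with z hx hy
    by_cases hz : z ∈ essSupport (φ x)
    · exact Or.inr (hy (Set.disjoint_left.1 (hφ.disjoint x y hxy) hz))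
    · exact Or.inl (hx hz)
  · filter_upwards [ae_eq_zero_of_notMem_essSupport (φ x)] with y hy hlt
    exact hy fun hmem => hlt.not_ge (hC x y hmem x (hφ.mem x))

variable [BorelSpace X]

/-- In an ample `L²(X)` every locally finite family of points of `D` carries a localized
orthonormal family. -/
theorem IsWannierBasis.exists_isLocalized_of_finite [ProperSpace X] (hm : IsAmple m) {D : Set X}
    (hD : UniformlyDiscrete D) {φ : D → L2 m} (hφ : IsWannierBasis D φ) {T : Type*} [Countable T]
    {c : T → D} (hc : ∀ (y : X) (r : ℝ), {t : T | dist (c t : X) y ≤ r}.Finite) :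
    ∃ (R : ℝ) (u : T → L2 m), IsLocalized R (fun t => (c t : X)) u := by
  have : Encodable T := Encodable.ofCountable T
  obtain ⟨ε, hε, hsep⟩ := hD
  choose e he hsupp using fun y : D => hm.exists_orthonormal (hφ.mem y) (half_pos hε)
  -- Rays may pass through the same point: the index `encode t` then picks different members of one
  -- orthonormal sequence. At distinct points the radius `ε / 2` makes the supports disjoint.
  refine ⟨ε / 2, fun t => e (c t) (Encodable.encode t), ⟨fun t => (he _).1 _, fun s t hst => ?_⟩,
    fun t => ?_, hc⟩
  · by_cases hcst : c s = c t
    · dsimp only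
      rw [hcst]
      exact (he _).2 (Encodable.encode_injective.ne hst)
    · refine inner_eq_zero_of_ae ?_
      filter_upwards [hsupp (c s) (Encodable.encode s), hsupp (c t) (Encodable.encode t)]
        with y hs ht
      rcases le_or_gt (ε / 2) (dist y (c s)) with h | h
      · exact Or.inl (hs h)
      · refine Or.inr (ht ?_)
        have h1 := hsep _ (c s).2 _ (c t).2 fun h => hcst (Subtype.ext h)
        linarith [dist_triangle_left (c s : X) (c t) y]
  · filter_upwards [hsupp (c t) (Encodable.encode t)] with y hy hlt
    exact hy hlt.le

end Wannier

/-! ### The swindle -/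

/-- The bijection `D ⊔ D × ℕ ≃ D × ℕ` which takes `x` to `(x, 0)` and `(x, n)` to `(x, n + 1)`. -/
def sumProdNatEquiv (D : Type*) : D ⊕ D × ℕ ≃ D × ℕ where
  toFun := Sum.elim (fun x => (x, 0)) (fun t => (t.1, t.2 + 1))
  invFun t := Nat.casesOn t.2 (Sum.inl t.1) (fun n => Sum.inr (t.1, n))
  left_inv := by rintro (x | ⟨x, n⟩) <;> rfl
  right_inv := by rintro ⟨x, _ | n⟩ <;> rfl

theorem corollary3p8 {X : Type*} [MetricSpace X] [MeasurableSpace X] [BorelSpace X]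
    [ProperSpace X] [ConnectedSpace X] [NoncompactSpace X]
    (m : MeasureTheory.Measure X) (hample : RoeAlgebra.IsAmple m)
    (hX : Wannier.HasBoundedGeometry X)
    (D : Set X) (hD : Wannier.UniformlyDiscrete D) (hDX : Wannier.CoarselyDense D)
    (φ : D → RoeAlgebra.L2 m) (hφ : Wannier.IsWannierBasis D φ) :
    ∃ (p : RoeAlgebra.roeAlgebra m) (hp : IsStarProjection p),
      (p : RoeAlgebra.L2 m →L[ℂ] RoeAlgebra.L2 m) = Wannier.proj φ ∧
        KTheory.K0.mk p hp = 0 := by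
  have := hD.countable
  obtain ⟨K, γ, hγ0, hγ, hγfin⟩ := Wannier.exists_coarse_rays hD hDX
  obtain ⟨R, h⟩ := hφ.exists_isLocalized hD
  obtain ⟨R', u, hu⟩ := hφ.exists_isLocalized_of_finite hample hD hγfin
  -- `hu0` concerns the starting functions `u (x, 0)`, the targets of `v`; `hu1` concerns the
  -- shifted family `u (x, n + 1)`, the targets of `w`.
  have hu0 := hu.comp (i := fun x : D => (x, 0)) fun x y hxy => congrArg Prod.fst hxy
  have hu1 := hu.comp (i := fun t : D × ℕ => (t.1, t.2 + 1)) fun s t hst =>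
    by simpa [Prod.ext_iff] using hst
  let p : RoeAlgebra.roeAlgebra m := ⟨_, h.transfer_mem_roeAlgebra h (K := 0) fun x => by simp⟩
  let q : RoeAlgebra.roeAlgebra m := ⟨_, hu.transfer_mem_roeAlgebra hu (K := 0) fun x => by simp⟩
  let v : RoeAlgebra.roeAlgebra m :=
    -- The constant is `0` because the ray from `x` starts at `x` itself.
    ⟨_, h.transfer_mem_roeAlgebra hu0 (K := 0) fun x => by simp [hγ0]⟩
  let w : RoeAlgebra.roeAlgebra m := ⟨_, hu.transfer_mem_roeAlgebra hu1 fun t => hγ t.1 t.2⟩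
  have hp : IsStarProjection p :=
    ⟨Subtype.ext (Orthonormal.transfer_mul_transfer _ _ _),
      Subtype.ext (Orthonormal.star_transfer _ _)⟩
  have hq : IsStarProjection q :=
    ⟨Subtype.ext (Orthonormal.transfer_mul_transfer _ _ _),
      Subtype.ext (Orthonormal.star_transfer _ _)⟩
  refine ⟨p, hp, h.orthonormal.transfer_self, KTheory.K0.mk_eq_zero_of_row hp hq (v := v) (w := w)
    (Subtype.ext ?_) (Subtype.ext ?_) (Subtype.ext ?_) (Subtype.ext ?_)⟩
  · change star (Orthonormal.transfer _ _) * Orthonormal.transfer _ _ = Orthonormal.transfer _ _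
    rw [Orthonormal.star_transfer, Orthonormal.transfer_mul_transfer]
  · change star (Orthonormal.transfer _ _) * Orthonormal.transfer _ _ = Orthonormal.transfer _ _
    rw [Orthonormal.star_transfer, Orthonormal.transfer_mul_transfer]
  · change star (Orthonormal.transfer _ _) * Orthonormal.transfer _ _ = 0
    rw [Orthonormal.star_transfer]
    exact Orthonormal.transfer_mul_transfer_eq_zero _ _ _ _ fun x t =>
      hu.orthonormal.2 fun hxt => Nat.succ_ne_zero _ (congrArg Prod.snd hxt).symm
  · change Orthonormal.transfer _ _ * star (Orthonormal.transfer _ _)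
      + Orthonormal.transfer _ _ * star (Orthonormal.transfer _ _) = Orthonormal.transfer _ _
    rw [Orthonormal.star_transfer, Orthonormal.star_transfer, Orthonormal.transfer_mul_transfer,
      Orthonormal.transfer_mul_transfer]
    exact hu.orthonormal.transfer_add_transfer (sumProdNatEquiv D) _ _ (fun _ => rfl) fun _ => rfl
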